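/- Let $M$ be a pointed metric space with metric $d$ and base point $0$. Let $\mathrm{Lip}_0(M)$ be the space of all Lipschitz functions $f\colon M\to\mathbb R$ with $f(0)=0$, with the norm $\|f\|=\sup_{x\neq y}|f(x)-f(y)|/d(x,y)$. Put $\widetilde M=\{(x,y)\in M\times M: x\ne y\}$ and, for $A\subseteq M$, $\Gamma_A=\{(x,y)\in\widetilde M: x\in A\text{ or }y\in A\}$. * $M$ has the function SLTP (FSLTP) if for every bounded finitely additive measure $\mu\ge 0$ on the power set of $\widetilde M$, every $\varepsilon\in(0,1)$, and all finite families $f_1,\dots,f_n\in\mathrm{Lip}_0(M)$ with $\|f_i\|\le 1$, there are $A\subseteq M$ with $\mu(\Gamma_A)<\varepsilon$ and $u,v\in A$, $u\ne v$, such that $$(1-\varepsilon)\bigl(f_i(x)-f_i(y)+d(u,v)\bigr)\le d(x,u)+d(y,v),$$ $$(1-\varepsilon)\bigl(f_i(x)-f_i(y)+f_j(z)-f_j(w)+2d(u,v)\bigr)\le d(x,u)+d(y,u)+d(z,v)+d(w,v)$$ for all $x,y,z,w\in M\setminus A$ and all $i,j\in\{1,\dots,n\}$. * $M$ has the seq-SLTP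 if for every $\varepsilon>0$ there are pairwise disjoint sets $A_1,A_2,\dots\subseteq M$ and points $u_m,v_m\in A_m$, $u_m\ne v_m$, such that for all $m$ and all $x,y,z,w\in M\setminus A_m$ $$(1-\varepsilon)\bigl(d(x,y)+d(u_m,v_m)\bigr)\le d(x,u_m)+d(y,v_m),$$ $$(1-\varepsilon)\bigl(2d(u_m,v_m)+d(x,y)+d(z,w)\bigr)\le d(x,u_m)+d(y,u_m)+d(z,v_m)+d(w,v_m).$$ * A real normed space $X$ with closed unit ball $B_X$ has the symmetric strong diameter 2 property (SSD2P) if for every finite family of slices $S_1,\dots,S_n$ of $B_X$ (sets $\{x\in B_X: x^*(x)>1-\alpha\}$ with $x^*\in X^*$, $\|x^*\|=1$, $\alpha>0$) and every $\varepsilon>0$ there are $f_i\in S_i$ and $g\in B_X$ with $\|g\|>1-\varepsilon$ and $f_i\pm g\in S_i$ for all $i$. Theorem. (1) If $M$ has the FSLTP, then $\mathrm{Lip}_0(M)$ has the SSD2P. (2) The FSLTP is strictly weaker than the seq-SLTP: every pointed metric space with the seq-SLTP has the FSLTP, and there is a pointed metric space that has the FSLTP but not the seq-SLTP. -/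

import Mathlib

open MeasureTheory

universe u

section LipschitzSpace

variable {M : Type u} [MetricSpace M]

variable (M) in
/-- The set of pairs `(x, y)` of distinct points of `M`. -/
abbrev OffDiagPair : Type u := {p : M × M // p.1 ≠ p.2}

/-- The set of those pairs of distinct points that have at least one coordinate in `A`. -/
def gammaSet (A : Set M) : Set (OffDiagPair M) := {p | p.1.1 ∈ A ∨ p.1.2 ∈ A}

/-- The real vector space of the Lipschitz functions on `M` that vanish at the base point `o`. -/
def lipZeroSubmodule (o : M) : Submodule ℝ (M → ℝ) where
  carrier := {f | (∃ K : NNReal, LipschitzWith K f) ∧ f o = 0}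
  add_mem' := by
    rintro f g ⟨⟨K, hf⟩, hf0⟩ ⟨⟨L, hg⟩, hg0⟩
    exact ⟨⟨K + L, hf.add hg⟩, by simp [hf0, hg0]⟩
  zero_mem' := ⟨⟨0, LipschitzWith.const 0⟩, rfl⟩
  smul_mem' := by
    rintro c f ⟨⟨K, hf⟩, hf0⟩
    refine ⟨⟨‖c‖₊ * K, (lipschitzWith_smul c).comp hf⟩, by simp [hf0]⟩

/-- The space `Lip₀(M)` of the pointed metric space `(M, o)`. -/
def LipZero (o : M) : Type u := lipZeroSubmodule o

namespace LipZero

variable {o : M}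

noncomputable instance : AddCommGroup (LipZero o) :=
  inferInstanceAs (AddCommGroup (lipZeroSubmodule o))

noncomputable instance : Module ℝ (LipZero o) :=
  inferInstanceAs (Module ℝ (lipZeroSubmodule o))

instance : FunLike (LipZero o) M ℝ where
  coe f := f.1
  coe_injective _ _ h := Subtype.ext h

@[ext] theorem ext {f g : LipZero o} (h : ∀ x, f x = g x) : f = g := DFunLike.ext _ _ h

@[simp] theorem zero_apply (x : M) : (0 : LipZero o) x = 0 := rfl

@[simp] theorem add_apply (f g : LipZero o) (x : M) : (f + g) x = f x + g x := rfl

@[simp] theorem smul_apply (c : ℝ) (f : LipZero o) (x : M) : (c • f) x = c * f x := rfl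

@[simp] theorem map_base (f : LipZero o) : f o = 0 := f.2.2

/-- The Lipschitz constant: the supremum of `|f x - f y| / d(x, y)` over `x ≠ y`. -/
noncomputable instance : Norm (LipZero o) where
  norm f := ⨆ p : OffDiagPair M, |f p.1.1 - f p.1.2| / dist p.1.1 p.1.2

theorem norm_def (f : LipZero o) :
    ‖f‖ = ⨆ p : OffDiagPair M, |f p.1.1 - f p.1.2| / dist p.1.1 p.1.2 := rfl

theorem bddAbove_quotients (f : LipZero o) :
    BddAbove (Set.range fun p : OffDiagPair M => |f p.1.1 - f p.1.2| / dist p.1.1 p.1.2) := by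
  obtain ⟨K, hK⟩ := f.2.1
  refine ⟨K, ?_⟩
  rintro _ ⟨p, rfl⟩
  have hp : 0 < dist p.1.1 p.1.2 := dist_pos.2 p.2
  have h := hK.dist_le_mul p.1.1 p.1.2
  rw [Real.dist_eq] at h
  exact (div_le_iff₀ hp).2 h

theorem abs_sub_le_norm_mul (f : LipZero o) (x y : M) : |f x - f y| ≤ ‖f‖ * dist x y := by
  by_cases h : x = y
  · simp [h]
  · have hp : 0 < dist x y := dist_pos.2 h
    exact (div_le_iff₀ hp).1 (le_ciSup (bddAbove_quotients f) (⟨(x, y), h⟩ : OffDiagPair M))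

theorem norm_le_of_forall (f : LipZero o) {C : ℝ} (hC : 0 ≤ C)
    (h : ∀ x y, |f x - f y| ≤ C * dist x y) : ‖f‖ ≤ C := by
  refine Real.iSup_le (fun p => ?_) hC
  exact (div_le_iff₀ (dist_pos.2 p.2)).2 (h _ _)

theorem norm_core : NormedSpace.Core ℝ (LipZero o) where
  norm_nonneg f := Real.iSup_nonneg fun p => by positivity
  norm_smul c f := by
    rw [norm_def, norm_def, Real.norm_eq_abs, Real.mul_iSup_of_nonneg (abs_nonneg c)]
    refine iSup_congr fun p => ?_
    rw [smul_apply, smul_apply, ← mul_sub, abs_mul, mul_div_assoc]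
  norm_triangle f g := by
    have hf : 0 ≤ ‖f‖ := Real.iSup_nonneg fun p => by positivity
    have hg : 0 ≤ ‖g‖ := Real.iSup_nonneg fun p => by positivity
    refine norm_le_of_forall _ (add_nonneg hf hg) fun x y => ?_
    have h : (f + g) x - (f + g) y = (f x - f y) + (g x - g y) := by
      simp only [add_apply]; ring
    rw [h, add_mul]
    exact (abs_add_le _ _).trans
      (add_le_add (abs_sub_le_norm_mul f x y) (abs_sub_le_norm_mul g x y))
  norm_eq_zero_iff f := by
    constructor
    · intro h
      ext x
      have := abs_sub_le_norm_mul f x o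
      rw [h, zero_mul, map_base, sub_zero] at this
      simpa using abs_nonpos_iff.1 this
    · rintro rfl
      simp [norm_def]

noncomputable instance : NormedAddCommGroup (LipZero o) := NormedAddCommGroup.ofCore norm_core

noncomputable instance : NormedSpace ℝ (LipZero o) := NormedSpace.ofCore norm_core

end LipZero

end LipschitzSpace

section DiameterTwo

variable {X : Type u} [NormedAddCommGroup X] [NormedSpace ℝ X]

/-- Slices of the closed unit ball of `X`: sets `{x ∈ B_X : φ x > 1 - α}` with `φ` a norm-one
functional and `α > 0`. -/
def IsSlice (S : Set X) : Prop :=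
  ∃ φ : StrongDual ℝ X, ‖φ‖ = 1 ∧ ∃ α : ℝ, 0 < α ∧ S = {x | ‖x‖ ≤ 1 ∧ 1 - α < φ x}

variable (X) in
/-- The symmetric strong diameter two property. -/
def SSD2P : Prop :=
  ∀ (n : ℕ) (S : Fin n → Set X), (∀ i, IsSlice (S i)) → ∀ ε : ℝ, 0 < ε →
    ∃ (f : Fin n → X) (g : X), (∀ i, f i ∈ S i) ∧ ‖g‖ ≤ 1 ∧ 1 - ε < ‖g‖ ∧
      ∀ i, f i + g ∈ S i ∧ f i - g ∈ S i

end DiameterTwo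

/-- The bounded finitely additive signed measures on the power set of `E`. -/
def ba (E : Type u) : Set (AddContent ℝ (Set.univ : Set (Set E))) :=
  {μ | ∃ C : ℝ, ∀ S : Set E, |μ S| ≤ C}

/-- The function SLTP of the pointed metric space `(M, o)`. -/
def FSLTP {M : Type u} [MetricSpace M] (o : M) : Prop :=
  ∀ μ ∈ ba (OffDiagPair M), (∀ S, 0 ≤ μ S) → ∀ ε : ℝ, 0 < ε → ε < 1 →
    ∀ (n : ℕ) (f : Fin n → LipZero o), (∀ i, ‖f i‖ ≤ 1) →
      ∃ (A : Set M) (u v : M), μ (gammaSet A) < ε ∧ u ∈ A ∧ v ∈ A ∧ u ≠ v ∧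
        (∀ x ∉ A, ∀ y ∉ A, ∀ i,
          (1 - ε) * (f i x - f i y + dist u v) ≤ dist x u + dist y v) ∧
        (∀ x ∉ A, ∀ y ∉ A, ∀ z ∉ A, ∀ w ∉ A, ∀ i j,
          (1 - ε) * (f i x - f i y + (f j z - f j w) + 2 * dist u v) ≤
            dist x u + dist y u + dist z v + dist w v)

/-- The sequential SLTP of the metric space `M`. -/
def SeqSLTP (M : Type u) [MetricSpace M] : Prop :=
  ∀ ε : ℝ, 0 < ε →
    ∃ (A : ℕ → Set M) (u v : ℕ → M), (∀ k l, k ≠ l → Disjoint (A k) (A l)) ∧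
      ∀ m, u m ∈ A m ∧ v m ∈ A m ∧ u m ≠ v m ∧
        (∀ x ∉ A m, ∀ y ∉ A m,
          (1 - ε) * (dist x y + dist (u m) (v m)) ≤ dist x (u m) + dist y (v m)) ∧
        (∀ x ∉ A m, ∀ y ∉ A m, ∀ z ∉ A m, ∀ w ∉ A m,
          (1 - ε) * (2 * dist (u m) (v m) + dist x y + dist z w) ≤
            dist x (u m) + dist y (u m) + dist z (v m) + dist w (v m))

/-! For (1), the difference-quotient map embeds `LipZero o` isometrically in a space of bounded
functions. Extending the slice functionals by Hahn–Banach and summing their variations gives one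
positive finitely additive measure `μ` that dominates them all. If `μ (gammaSet A)` is small,
changing a function inside `A` hardly affects the functionals. The FSLTP inequalities are what is
needed to flatten all `(1 - δ) • f i`, inside `A` only, on two balls around `u` and `v` whose radii
sum to `(1 - δ) * dist u v`. A positive cone on one ball and a negative cone on the other then form
`g`. Key lemmas: `exists_radii_centres`, `abs_clampAt_sub_add_abs_conePair_sub_le`.

For (2), disjoint sets `A k` have `μ (gammaSet (A k))` tending to zero, so seq-SLTP gives FSLTP. The
converse fails on a graph with distances 1 and 2: FSLTP needs only sets that cover each point at
most twice, while seq-SLTP would need disjoint sets that contain most of a vertex neighbourhood, and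
such neighbourhoods meet. -/

/-! ### Variation of functionals on bounded functions, and finitely additive measures. -/

section FinitelyAdditive

open Filter Topology
open scoped ENNReal

/-- The supremum of a functional over the bounded functions dominated by the indicator of `S`. -/
noncomputable def functionalVariation {ι : Type u} (Φ : StrongDual ℝ (lp (fun _ : ι => ℝ) ∞))
    (S : Set ι) : ℝ :=
  sSup {t | ∃ k : lp (fun _ : ι => ℝ) ∞, (∀ i, |k i| ≤ 1) ∧ (∀ i ∉ S, k i = 0) ∧ t = Φ k}

variable {ι : Type u} (Φ : StrongDual ℝ (lp (fun _ : ι => ℝ) ∞))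

theorem exists_lp_indicator (k : lp (fun _ : ι => ℝ) ∞) (S : Set ι) :
    ∃ k' : lp (fun _ : ι => ℝ) ∞, ∀ i, k' i = S.indicator (fun i => k i) i := by
  refine ⟨⟨S.indicator (fun i => k i), memℓp_infty ⟨‖k‖, ?_⟩⟩, fun i => rfl⟩
  rintro _ ⟨i, rfl⟩
  exact (norm_indicator_le_norm_self _ i).trans (lp.norm_apply_le_norm ENNReal.top_ne_zero k i)

theorem apply_le_opNorm_of_abs_le_one {k : lp (fun _ : ι => ℝ) ∞} (hk : ∀ i, |k i| ≤ 1) :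
    Φ k ≤ ‖Φ‖ := by
  have h : ‖k‖ ≤ 1 := lp.norm_le_of_forall_le zero_le_one hk
  calc Φ k ≤ ‖Φ k‖ := le_abs_self _
    _ ≤ ‖Φ‖ * ‖k‖ := Φ.le_opNorm k
    _ ≤ ‖Φ‖ := mul_le_of_le_one_right (norm_nonneg _) h

theorem le_functionalVariation {S : Set ι} {k : lp (fun _ : ι => ℝ) ∞} (hk : ∀ i, |k i| ≤ 1)
    (hS : ∀ i ∉ S, k i = 0) : Φ k ≤ functionalVariation Φ S := by
  refine le_csSup ⟨‖Φ‖, ?_⟩ ⟨k, hk, hS, rfl⟩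
  rintro _ ⟨k, hk, -, rfl⟩
  exact apply_le_opNorm_of_abs_le_one Φ hk

theorem functionalVariation_le {S : Set ι} {C : ℝ}
    (h : ∀ k : lp (fun _ : ι => ℝ) ∞, (∀ i, |k i| ≤ 1) → (∀ i ∉ S, k i = 0) → Φ k ≤ C) :
    functionalVariation Φ S ≤ C := by
  refine csSup_le ⟨0, 0, by simp, by simp, by simp⟩ ?_
  rintro _ ⟨k, hk, hS, rfl⟩
  exact h k hk hS

theorem functionalVariation_nonneg (S : Set ι) : 0 ≤ functionalVariation Φ S := by
  simpa using le_functionalVariation Φ (S := S) (k := 0) (by simp) (by simp)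

theorem functionalVariation_le_opNorm (S : Set ι) : functionalVariation Φ S ≤ ‖Φ‖ :=
  functionalVariation_le Φ fun _ hk _ => apply_le_opNorm_of_abs_le_one Φ hk

theorem functionalVariation_empty : functionalVariation Φ ∅ = 0 := by
  refine le_antisymm (functionalVariation_le Φ fun k _ hS => ?_) (functionalVariation_nonneg Φ ∅)
  have : k = 0 := by ext i; exact hS i (Set.notMem_empty i)
  simp [this]

/-- Cutting a competitor along `S` and `T` gives one inequality; adding competitors with disjoint
supports keeps the bound 1 and gives the other. -/
theorem functionalVariation_union {S T : Set ι} (h : Disjoint S T) :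
    functionalVariation Φ (S ∪ T) = functionalVariation Φ S + functionalVariation Φ T := by
  apply le_antisymm
  · refine functionalVariation_le Φ fun k hk hST => ?_
    obtain ⟨k₁, h₁⟩ := exists_lp_indicator k S
    obtain ⟨k₂, h₂⟩ := exists_lp_indicator k T
    have hsum : k = k₁ + k₂ := by
      ext i
      rw [lp.coeFn_add, Pi.add_apply, h₁, h₂]
      by_cases hS : i ∈ S
      · simp [hS, Set.disjoint_left.1 h hS]
      · by_cases hT : i ∈ T
        · simp [hS, hT]
        · simp [hS, hT, hST i (by simp [hS, hT])]
    rw [hsum, map_add]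
    refine add_le_add (le_functionalVariation Φ (fun i => ?_) fun i hi => ?_)
      (le_functionalVariation Φ (fun i => ?_) fun i hi => ?_)
    · rw [h₁, ← Real.norm_eq_abs]; exact (norm_indicator_le_norm_self _ i).trans (hk i)
    · rw [h₁]; simp [hi]
    · rw [h₂, ← Real.norm_eq_abs]; exact (norm_indicator_le_norm_self _ i).trans (hk i)
    · rw [h₂]; simp [hi]
  · rw [← le_sub_iff_add_le]
    refine functionalVariation_le Φ fun k hk hS => ?_
    rw [le_sub_comm]
    refine functionalVariation_le Φ fun l hl hT => ?_
    rw [le_sub_iff_add_le, ← map_add]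
    refine le_functionalVariation Φ (fun i => ?_) fun i hi => ?_
    · rw [lp.coeFn_add, Pi.add_apply]
      by_cases hi : i ∈ S
      · simpa [hT i (Set.disjoint_left.1 h hi)] using hk i
      · simpa [hS i hi] using hl i
    · rw [Set.mem_union, not_or] at hi
      simp [hS i hi.1, hT i hi.2]

theorem abs_apply_le_norm_mul_functionalVariation {S : Set ι} {k : lp (fun _ : ι => ℝ) ∞}
    {C : ℝ} (hC : 0 ≤ C) (hk : ∀ i, |k i| ≤ C) (hS : ∀ i ∉ S, k i = 0) :
    |Φ k| ≤ C * functionalVariation Φ S := by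
  rcases hC.eq_or_lt with rfl | hC
  · have : k = 0 := by ext i; simpa using hk i
    simp [this]
  have key : ∀ l : lp (fun _ : ι => ℝ) ∞, (∀ i, |l i| ≤ C) → (∀ i ∉ S, l i = 0) →
      Φ l ≤ C * functionalVariation Φ S := by
    intro l hl hlS
    have := le_functionalVariation Φ (S := S) (k := C⁻¹ • l) (fun i => ?_) fun i hi => ?_
    · rw [map_smul, smul_eq_mul, inv_mul_le_iff₀ hC] at this
      exact this
    · rw [lp.coeFn_smul, Pi.smul_apply, smul_eq_mul, abs_mul, abs_of_pos (inv_pos.2 hC),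
        inv_mul_le_iff₀ hC, mul_one]
      exact hl i
    · simp [hlS i hi]
  refine abs_le'.2 ⟨key k hk hS, ?_⟩
  rw [← map_neg]
  exact key (-k) (by simpa using hk) (by simpa using hS)

theorem isSetRing_univ {α : Type*} : IsSetRing (Set.univ : Set (Set α)) :=
  ⟨Set.mem_univ _, fun _ _ _ _ => Set.mem_univ _, fun _ _ _ _ => Set.mem_univ _⟩

/-- Finitely many functionals on bounded functions are simultaneously dominated by a positive
finitely additive measure. -/
theorem exists_ba_dominating {n : ℕ} (Φ : Fin n → StrongDual ℝ (lp (fun _ : ι => ℝ) ∞)) :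
    ∃ μ ∈ ba ι, (∀ S, 0 ≤ μ S) ∧ ∀ j S (k : lp (fun _ : ι => ℝ) ∞) (C : ℝ), 0 ≤ C →
      (∀ i, |k i| ≤ C) → (∀ i ∉ S, k i = 0) → |Φ j k| ≤ C * μ S := by
  have hnn : ∀ j S, 0 ≤ functionalVariation (Φ j) S := fun j => functionalVariation_nonneg (Φ j)
  refine ⟨isSetRing_univ.addContent_of_union (fun S => ∑ j, functionalVariation (Φ j) S)
    (by simp [functionalVariation_empty]) fun _ _ h => ?_, ⟨∑ j, ‖Φ j‖, fun S => ?_⟩,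
    fun S => Finset.sum_nonneg fun j _ => hnn j S, fun j S k C hC hk hS => ?_⟩
  · rw [← Finset.sum_add_distrib]
    exact Finset.sum_congr rfl fun j _ => functionalVariation_union (Φ j) h
  · change |∑ j, functionalVariation (Φ j) S| ≤ _
    rw [abs_of_nonneg (Finset.sum_nonneg fun j _ => hnn j S)]
    exact Finset.sum_le_sum fun j _ => functionalVariation_le_opNorm (Φ j) S
  · refine (abs_apply_le_norm_mul_functionalVariation (Φ j) hC hk hS).trans
      (mul_le_mul_of_nonneg_left ?_ hC)
    exact Finset.single_le_sum (f := fun j => functionalVariation (Φ j) S)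
      (fun j _ => hnn j S) (Finset.mem_univ j)

variable {E : Type u} {μ : AddContent ℝ (Set.univ : Set (Set E))}

theorem addContent_univ_union {S T : Set E} (h : Disjoint S T) : μ (S ∪ T) = μ S + μ T :=
  addContent_union' (Set.mem_univ _) (Set.mem_univ _) (Set.mem_univ _) h

theorem addContent_univ_mono (hμ : ∀ S, 0 ≤ μ S) {S T : Set E} (h : S ⊆ T) : μ S ≤ μ T := by
  rw [← Set.union_sdiff_cancel h, addContent_univ_union Set.disjoint_sdiff_right]
  exact le_add_of_nonneg_right (hμ _)

theorem addContent_univ_union_le (hμ : ∀ S, 0 ≤ μ S) (S T : Set E) :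
    μ (S ∪ T) ≤ μ S + μ T := by
  rw [← Set.union_sdiff_self, addContent_univ_union Set.disjoint_sdiff_right]
  exact add_le_add le_rfl (addContent_univ_mono hμ Set.sdiff_subset)

/-- The partial sums of `μ (S k)` are bounded by `μ Set.univ`, so the series converges. -/
theorem tendsto_addContent_zero_of_disjoint (hμ : ∀ S, 0 ≤ μ S) {S : ℕ → Set E}
    (hS : ∀ k l, k ≠ l → Disjoint (S k) (S l)) : Tendsto (fun k => μ (S k)) atTop (𝓝 0) := by
  refine (summable_of_sum_range_le (c := μ Set.univ) (fun k => hμ _) fun n => ?_).tendsto_atTop_zero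
  rw [← addContent_biUnion (fun _ _ => Set.mem_univ _) (fun k _ l _ h => hS k l h)
    (Set.mem_univ _)]
  exact addContent_univ_mono hμ (Set.subset_univ _)

/-- If every point lies in boundedly many of the sets `A k`, by virtue of a cover of each `A k` by
members of two disjoint sequences, then `μ (gammaSet (A k))` tends to zero. -/
theorem tendsto_addContent_gammaSet {M : Type u} [MetricSpace M]
    {μ : AddContent ℝ (Set.univ : Set (Set (OffDiagPair M)))} (hμ : ∀ S, 0 ≤ μ S)
    {A B C : ℕ → Set M} (hB : ∀ k l, k ≠ l → Disjoint (B k) (B l))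
    (hC : ∀ k l, k ≠ l → Disjoint (C k) (C l)) (hA : ∀ k, A k ⊆ B k ∪ C k) :
    Tendsto (fun k => μ (gammaSet (A k))) atTop (𝓝 0) := by
  have key : ∀ D : ℕ → Set M, (∀ k l, k ≠ l → Disjoint (D k) (D l)) →
      Tendsto (fun k => μ (gammaSet (D k))) atTop (𝓝 0) := by
    intro D hD
    have h₁ := tendsto_addContent_zero_of_disjoint hμ
      (S := fun k => (fun p : OffDiagPair M => p.1.1) ⁻¹' D k) fun k l h => (hD k l h).preimage _
    have h₂ := tendsto_addContent_zero_of_disjoint hμ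
      (S := fun k => (fun p : OffDiagPair M => p.1.2) ⁻¹' D k) fun k l h => (hD k l h).preimage _
    refine squeeze_zero (fun k => hμ _) (fun k => ?_) (by simpa using h₁.add h₂)
    exact addContent_univ_union_le hμ _ _
  refine squeeze_zero (fun k => hμ _) (fun k => ?_) (by simpa using (key B hB).add (key C hC))
  refine (addContent_univ_mono hμ ?_).trans (addContent_univ_union_le hμ _ _)
  rintro p (h | h)
  · exact (hA k h).imp Or.inl Or.inl
  · exact (hA k h).imp Or.inr Or.inr

end FinitelyAdditive

/-! ### The seq-SLTP implies the FSLTP. -/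

theorem SeqSLTP.fsltp {M : Type u} [MetricSpace M] (o : M) (h : SeqSLTP M) : FSLTP o := by
  intro μ _ hμ ε hε hε1 n f hf
  obtain ⟨A, u, v, hdisj, hA⟩ := h ε hε
  obtain ⟨m, hm⟩ := ((tendsto_addContent_gammaSet hμ hdisj hdisj
    fun k => Set.subset_union_left).eventually (gt_mem_nhds hε)).exists
  obtain ⟨hu, hv, huv, h1, h2⟩ := hA m
  have hf' : ∀ i x y, f i x - f i y ≤ dist x y := fun i x y =>
    ((le_abs_self _).trans ((f i).abs_sub_le_norm_mul x y)).trans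
      (mul_le_of_le_one_left dist_nonneg (hf i))
  refine ⟨A m, u m, v m, hm, hu, hv, huv, fun x hx y hy i => ?_, fun x hx y hy z hz w hw i j => ?_⟩
  · refine (mul_le_mul_of_nonneg_left ?_ (by linarith)).trans (h1 x hx y hy)
    linarith [hf' i x y]
  · refine (mul_le_mul_of_nonneg_left ?_ (by linarith)).trans (h2 x hx y hy z hz w hw)
    linarith [hf' i x y, hf' j z w]

/-! ### A space with the FSLTP but not the seq-SLTP. -/

/-- Vertices generated freely from countably many base points: every pair of vertices `a`, `b` has
the children `node a b k`. -/
inductive FreeVertex : Type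
  | base (n : ℕ)
  | node (a b : FreeVertex) (k : ℕ)

namespace FreeVertex

/-- The first parent of a vertex; a base point is its own parent. -/
def left : FreeVertex → FreeVertex
  | base n => base n
  | node a _ _ => a

/-- The second parent of a vertex; a base point is its own parent. -/
def right : FreeVertex → FreeVertex
  | base n => base n
  | node _ b _ => b

/-- Two vertices are adjacent if they are distinct and one of them is a parent of the other. -/
def Adj (x y : FreeVertex) : Prop :=
  x ≠ y ∧ (x = y.left ∨ x = y.right ∨ y = x.left ∨ y = x.right)

theorem Adj.symm {x y : FreeVertex} (h : Adj x y) : Adj y x := ⟨h.1.symm, by have := h.2; tauto⟩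

theorem sizeOf_left_le (x : FreeVertex) : sizeOf x.left ≤ sizeOf x := by
  cases x <;> simp [left]; omega

theorem sizeOf_right_le (x : FreeVertex) : sizeOf x.right ≤ sizeOf x := by
  cases x <;> simp [right]; omega

theorem exists_common_neighbor {p q x y : FreeVertex} (hxp : x ≠ p) (hxq : x ≠ q) (hyp : y ≠ p)
    (hyq : y ≠ q) : ∃ c, Adj c p ∧ Adj c q ∧ c ≠ x ∧ ¬ Adj c x ∧ c ≠ y ∧ ¬ Adj c y := by
  -- The index makes `c` larger than `x` and `y`, so `c` is neither of them nor a parent of either;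
  -- its own parents are only `p` and `q`.
  set c := node p q (sizeOf x + sizeOf y) with hc
  have hs : sizeOf p < sizeOf c ∧ sizeOf q < sizeOf c ∧ sizeOf x < sizeOf c ∧
      sizeOf y < sizeOf c := by
    simp only [hc, node.sizeOf_spec, sizeOf_nat]; omega
  have hne : ∀ z, sizeOf z < sizeOf c → c ≠ z := fun z hz h => by rw [h] at hz; omega
  have hadj : ∀ z, sizeOf z < sizeOf c → z ≠ p → z ≠ q → ¬ Adj c z := by
    rintro z hz hp hq ⟨-, h | h | h | h⟩
    · exact hne _ ((sizeOf_left_le z).trans_lt hz) h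
    · exact hne _ ((sizeOf_right_le z).trans_lt hz) h
    · exact hp h
    · exact hq h
  exact ⟨c, ⟨hne _ hs.1, .inr (.inr (.inl rfl))⟩, ⟨hne _ hs.2.1, .inr (.inr (.inr rfl))⟩,
    hne _ hs.2.2.1, hadj _ hs.2.2.1 hxp hxq, hne _ hs.2.2.2, hadj _ hs.2.2.2 hyp hyq⟩

open Classical in
/-- Adjacent vertices have distance `1`, other distinct vertices have distance `2`. -/
noncomputable instance : MetricSpace FreeVertex where
  dist x y := if x = y then 0 else if Adj x y then 1 else 2
  dist_self x := if_pos rfl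
  dist_comm x y := by
    have : Adj x y ↔ Adj y x := ⟨Adj.symm, Adj.symm⟩
    simp only [this, eq_comm]
  dist_triangle x y z := by
    by_cases hxy : x = y
    · simp [hxy]
    by_cases hyz : y = z
    · simp [hyz]
    simp only [hxy, hyz, if_false]
    split_ifs <;> norm_num
  eq_of_dist_eq_zero {x y} h := by
    by_contra hxy
    simp only [hxy, if_false] at h
    split_ifs at h <;> norm_num at h

theorem dist_eq_one {x y : FreeVertex} (h : Adj x y) : dist x y = 1 :=
  (if_neg h.1).trans (if_pos h)

theorem dist_eq_two {x y : FreeVertex} (hne : x ≠ y) (h : ¬ Adj x y) : dist x y = 2 :=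
  (if_neg hne).trans (if_neg h)

theorem dist_le_two (x y : FreeVertex) : dist x y ≤ 2 := by
  by_cases hne : x = y
  · simp [hne]
  by_cases h : Adj x y
  · rw [dist_eq_one h]; norm_num
  · rw [dist_eq_two hne h]

theorem one_le_dist {x y : FreeVertex} (hne : x ≠ y) : 1 ≤ dist x y := by
  by_cases h : Adj x y
  · rw [dist_eq_one h]
  · rw [dist_eq_two hne h]; norm_num

theorem dist_base_eq_two {x : FreeVertex} {n : ℕ} (hl : x.left ≠ base n) (hr : x.right ≠ base n) :
    dist x (base n) = 2 := by
  have hne : x ≠ base n := by rintro rfl; exact hl rfl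
  refine dist_eq_two hne ?_
  rintro ⟨-, h | h | h | h⟩
  exacts [hne h, hne h, hl h.symm, hr h.symm]

/-- Take `A` to be all vertices with a parent in a pair of base points. Outside `A` both base points
are at the maximal distance 2, so the right-hand sides are 4 and 8. A vertex has two parents, so two
disjoint sequences of preimages cover these sets. -/
theorem fsltp (o : FreeVertex) : FSLTP o := by
  intro μ _ hμ ε hε hε1 n f hf
  let P : ℕ → Set FreeVertex := fun k => {base (2 * k), base (2 * k + 1)}
  have hP : ∀ k l, k ≠ l → Disjoint (P k) (P l) := by
    intro k l h
    rw [Set.disjoint_left]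
    rintro _ (rfl | rfl) (h' | h') <;> simp only [Set.mem_singleton_iff, base.injEq] at h' <;> omega
  obtain ⟨k, hk⟩ := ((tendsto_addContent_gammaSet hμ
    (fun k l h => (hP k l h).preimage left) (fun k l h => (hP k l h).preimage right)
    fun k => subset_rfl).eventually (gt_mem_nhds hε)).exists
  set A := left ⁻¹' P k ∪ right ⁻¹' P k
  have hA : ∀ x ∉ A, dist x (base (2 * k)) = 2 ∧ dist x (base (2 * k + 1)) = 2 := by
    intro x hx
    simp only [A, P, Set.mem_union, Set.mem_preimage, Set.mem_insert_iff, Set.mem_singleton_iff,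
      not_or] at hx
    exact ⟨dist_base_eq_two hx.1.1 hx.2.1, dist_base_eq_two hx.1.2 hx.2.2⟩
  have hf' : ∀ i x y, f i x - f i y ≤ 2 := fun i x y =>
    (((le_abs_self _).trans ((f i).abs_sub_le_norm_mul x y)).trans
      (mul_le_of_le_one_left dist_nonneg (hf i))).trans (dist_le_two x y)
  have hd := dist_le_two (base (2 * k)) (base (2 * k + 1))
  refine ⟨A, base (2 * k), base (2 * k + 1), hk, .inl (.inl rfl), .inl (.inr rfl), by simp,
    fun x hx y hy i => ?_, fun x hx y hy z hz w hw i j => ?_⟩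
  · rw [(hA x hx).1, (hA y hy).2]
    nlinarith [hf' i x y]
  · rw [(hA x hx).1, (hA y hy).1, (hA z hz).2, (hA w hw).2]
    nlinarith [hf' i x y, hf' j z w]

/-- A set that isolates two points must contain most of a neighbourhood of one of them. -/
theorem exists_neighbors_subset {A : Set FreeVertex} {u v : FreeVertex} (hu : u ∈ A) (hv : v ∈ A)
    (huv : u ≠ v) (h : ∀ x ∉ A, ∀ y ∉ A,
      (1 - 1 / 10 : ℝ) * (dist x y + dist u v) ≤ dist x u + dist y v) :
    ∃ p ∈ A, ∃ x, x ≠ p ∧ ∀ c, Adj c p → c ≠ x → ¬ Adj c x → c ∈ A := by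
  by_cases hN : ∀ c, Adj c u → c ∈ A
  · exact ⟨u, hu, v, huv.symm, fun c hc _ _ => hN c hc⟩
  push Not at hN
  obtain ⟨x, hxu, hx⟩ := hN
  refine ⟨v, hv, x, fun h => hx (h ▸ hv), fun c hcv hcx hadj => ?_⟩
  by_contra hc
  -- Nonadjacent `x` and `c` would give `0.9 * (2 + 1) ≤ 1 + 1`.
  have := h x hx c hc
  rw [dist_eq_one hxu, dist_eq_one hcv, dist_eq_two hcx.symm fun h => hadj h.symm] at this
  linarith [one_le_dist huv]

theorem not_seqSLTP : ¬ SeqSLTP FreeVertex := by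
  intro h
  obtain ⟨A, u, v, hdisj, hA⟩ := h (1 / 10) (by norm_num)
  choose p hp x hxp hc using fun m =>
    exists_neighbors_subset (hA m).1 (hA m).2.1 (hA m).2.2.1 (hA m).2.2.2.1
  have hpp : ∀ m n, m ≠ n → p m ≠ p n := fun m n hmn h =>
    Set.disjoint_left.1 (hdisj m n hmn) (hp m) (h ▸ hp n)
  -- Otherwise a common neighbour of `p m` and `p n` avoiding both exceptional points would lie in
  -- two disjoint sets.
  have key : ∀ m n, m ≠ n → x m = p n ∨ x n = p m := by
    intro m n hmn
    by_contra! hne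
    obtain ⟨c, h₁, h₂, h₃, h₄, h₅, h₆⟩ := exists_common_neighbor (hxp m) hne.1 hne.2 (hxp n)
    exact Set.disjoint_left.1 (hdisj m n hmn) (hc m c h₁ h₃ h₄) (hc n c h₂ h₅ h₆)
  have huniq : ∀ k m n, m ≠ n → x k = p m → x k ≠ p n := fun k m n hmn h h' =>
    hpp m n hmn (h.symm.trans h')
  have := key 0 1 (by simp)
  have := key 0 2 (by simp)
  have := key 0 3 (by simp)
  have := key 1 2 (by simp)
  have := key 1 3 (by simp)
  have := key 2 3 (by simp)
  -- Four indices form six pairs, but each of the four `x k` equals at most one `p n`.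
  grind

end FreeVertex

/-! ### Flattening on two balls and adding opposite cones. -/

section TwoBalls

variable {M : Type u} [MetricSpace M] (u v : M) (r s : ℝ)

/-- The difference of the cones of heights `r` and `s` over the balls `B(u, r)` and `B(v, s)`. -/
noncomputable def conePair (x : M) : ℝ := max (r - dist x u) 0 - max (s - dist x v) 0

/-- The distance to the union of `B(u, r)` and `B(v, s)`, as measured from the centres. -/
noncomputable def ballsDist (x : M) : ℝ := min (max (dist x u - r) 0) (max (dist x v - s) 0)

/-- The truncation of `F` to the band of half-width `ballsDist` around the value `a`. -/
noncomputable def clampAt (a : ℝ) (F : M → ℝ) (x : M) : ℝ :=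
  max (a - ballsDist u v r s x) (min (a + ballsDist u v r s x) (F x))

variable {u v r s} {a : ℝ} {F : M → ℝ}

theorem abs_ballsDist_sub_le (x y : M) :
    |ballsDist u v r s x - ballsDist u v r s y| ≤ dist x y := by
  have key : ∀ (w : M) (t : ℝ), |max (dist x w - t) 0 - max (dist y w - t) 0| ≤ dist x y :=
    fun w t => (abs_max_sub_max_le_abs _ _ _).trans
      (by simpa using abs_dist_sub_le x y w)
  exact (abs_min_sub_min_le_max _ _ _ _).trans (max_le (key u r) (key v s))

theorem abs_clampAt_sub_le (hF : ∀ x y, |F x - F y| ≤ dist x y) (x y : M) :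
    |clampAt u v r s a F x - clampAt u v r s a F y| ≤ dist x y := by
  have hW := abs_ballsDist_sub_le (u := u) (v := v) (r := r) (s := s) x y
  refine (abs_max_sub_max_le_max _ _ _ _).trans (max_le ?_
    ((abs_min_sub_min_le_max _ _ _ _).trans (max_le ?_ (hF x y))))
  · rw [sub_sub_sub_cancel_left, abs_sub_comm]; exact hW
  · rw [add_sub_add_left_eq_sub]; exact hW

theorem ballsDist_nonneg (x : M) : 0 ≤ ballsDist u v r s x :=
  le_min (le_max_right _ _) (le_max_right _ _)

theorem abs_clampAt_sub_const_le (x : M) :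
    |clampAt u v r s a F x - a| ≤ ballsDist u v r s x := by
  have hW := ballsDist_nonneg (u := u) (v := v) (r := r) (s := s) x
  rw [abs_le]
  constructor
  · have : a - ballsDist u v r s x ≤ clampAt u v r s a F x := le_max_left _ _
    linarith
  · have : clampAt u v r s a F x ≤ a + ballsDist u v r s x :=
      max_le (by linarith) (min_le_left _ _)
    linarith

theorem clampAt_eq_of_abs_sub_le {x : M} (hu : |F x - a| + r ≤ dist x u)
    (hv : |F x - a| + s ≤ dist x v) : clampAt u v r s a F x = F x := by
  have h : |F x - a| ≤ ballsDist u v r s x :=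
    le_min (le_max_of_le_left (by linarith)) (le_max_of_le_left (by linarith))
  rw [abs_le] at h
  rw [clampAt, min_eq_right (by linarith), max_eq_right (by linarith)]

theorem conePair_eq_zero {x : M} (hu : r ≤ dist x u) (hv : s ≤ dist x v) :
    conePair u v r s x = 0 := by
  rw [conePair, max_eq_right (by linarith), max_eq_right (by linarith), sub_self]

/-- The balls are disjoint because `r + s ≤ dist u v`, so a point lies in one of them or in neither.
-/
theorem conePair_clampAt_cases (hrs : r + s ≤ dist u v) (x : M) :
    (clampAt u v r s a F x = a ∧ conePair u v r s x = r - dist x u ∧ dist x u < r) ∨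
      (clampAt u v r s a F x = a ∧ conePair u v r s x = dist x v - s ∧ dist x v < s) ∨
      (conePair u v r s x = 0 ∧ |clampAt u v r s a F x - a| ≤ dist x u - r ∧
        |clampAt u v r s a F x - a| ≤ dist x v - s) := by
  have htri := dist_triangle_left u v x
  have hW := abs_clampAt_sub_const_le (u := u) (v := v) (r := r) (s := s) (a := a) (F := F) x
  by_cases hu : dist x u < r
  · refine .inl ⟨?_, ?_, hu⟩
    · rw [ballsDist, max_eq_right (by linarith : dist x u - r ≤ 0)] at hW
      have := abs_nonpos_iff.1 (hW.trans (min_le_left _ _))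
      linarith
    · rw [conePair, max_eq_left (by linarith), max_eq_right (by linarith), sub_zero]
  by_cases hv : dist x v < s
  · refine .inr (.inl ⟨?_, ?_, hv⟩)
    · rw [ballsDist, max_eq_right (by linarith : dist x v - s ≤ 0)] at hW
      have := abs_nonpos_iff.1 (hW.trans (min_le_right _ _))
      linarith
    · rw [conePair, max_eq_right (by linarith), max_eq_left (by linarith)]; ring
  · push Not at hu hv
    rw [ballsDist, max_eq_left (by linarith), max_eq_left (by linarith)] at hW
    exact .inr (.inr ⟨conePair_eq_zero hu hv, le_min_iff.1 hW⟩)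

/-- Outside both balls the cones vanish; inside, the clamped function is constant. For `x` in `B(u,
r)` and `y` outside both balls, the sum is at most `(r - dist x u) + (dist y u - r)`. -/
theorem abs_clampAt_sub_add_abs_conePair_sub_le (hF : ∀ x y, |F x - F y| ≤ dist x y)
    (hrs : r + s ≤ dist u v) (x y : M) :
    |clampAt u v r s a F x - clampAt u v r s a F y| +
      |conePair u v r s x - conePair u v r s y| ≤ dist x y := by
  have hL := abs_clampAt_sub_le (u := u) (v := v) (r := r) (s := s) (a := a) hF x y
  have t₁ := dist_triangle x y u
  have t₂ := dist_triangle x y v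
  have t₃ := dist_triangle_left y u x
  have t₄ := dist_triangle_left y v x
  have t₅ := dist_triangle_left u v x
  have t₆ := dist_triangle_left u v y
  rcases conePair_clampAt_cases (a := a) (F := F) hrs x with
    ⟨h₁, h₂, h₃⟩ | ⟨h₁, h₂, h₃⟩ | ⟨h₁, h₂, h₃⟩ <;>
  rcases conePair_clampAt_cases (a := a) (F := F) hrs y with
    ⟨k₁, k₂, k₃⟩ | ⟨k₁, k₂, k₃⟩ | ⟨k₁, k₂, k₃⟩ <;>
  first
  | (rw [h₁, h₂, k₁, k₂, sub_self, abs_zero, zero_add, abs_le]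
     constructor <;> linarith)
  | (rw [h₁, h₂, k₁, sub_zero, abs_sub_comm a]
     rcases abs_cases (r - dist x u) with h | h <;>
     rcases abs_cases (dist x v - s) with h' | h' <;> linarith)
  | (rw [k₁, k₂, h₁, zero_sub, abs_neg]
     rcases abs_cases (r - dist y u) with h | h <;>
     rcases abs_cases (dist y v - s) with h' | h' <;> linarith)
  | (rw [h₁, k₁, sub_self, abs_zero, add_zero]; exact hL)

end TwoBalls

/-! ### Choosing the radii and the flat values. -/

section Parameters

variable {M : Type u} [MetricSpace M] {ι : Type*} {A : Set M} {u v : M} {D : ℝ} {F : ι → M → ℝ}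

/-- The conditions bound `r` above and, through `s = D - r`, below. The hypothesis `h` says that
every lower bound is at most every upper bound; the extra bounds `0` and `D` keep `r` and `s`
nonnegative. -/
theorem exists_radii (hD : 0 ≤ D) (hF : ∀ i x y, |F i x - F i y| ≤ dist x y)
    (h : ∀ x ∉ A, ∀ y ∉ A, ∀ z ∉ A, ∀ w ∉ A, ∀ i j,
      F i x - F i y + (F j z - F j w) + 2 * D ≤ dist x u + dist y u + dist z v + dist w v) :
    ∃ r s : ℝ, 0 ≤ r ∧ 0 ≤ s ∧ r + s = D ∧ ∀ x ∉ A, ∀ y ∉ A, ∀ i,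
      F i x - F i y + 2 * r ≤ dist x u + dist y u ∧
        F i x - F i y + 2 * s ≤ dist x v + dist y v := by
  have hF' : ∀ (p : M) i x y, F i x - F i y ≤ dist x p + dist y p := fun p i x y =>
    (le_abs_self _).trans ((hF i x y).trans (dist_triangle_right x y p))
  obtain ⟨r, hL, hU⟩ := exists_between_of_forall_le
    (s := {l | l = 0 ∨ ∃ i, ∃ x ∉ A, ∃ y ∉ A,
      l = D - (dist x v + dist y v - (F i x - F i y)) / 2})
    (t := {t | t = D ∨ ∃ i, ∃ x ∉ A, ∃ y ∉ A, t = (dist x u + dist y u - (F i x - F i y)) / 2})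
    ⟨0, .inl rfl⟩ ⟨D, .inl rfl⟩ (by
      rintro _ (rfl | ⟨j, z, hz, w, hw, rfl⟩) _ (rfl | ⟨i, x, hx, y, hy, rfl⟩)
      · exact hD
      · linarith [hF' u i x y]
      · linarith [hF' v j z w]
      · linarith [h x hx y hy z hz w hw i j])
  refine ⟨r, D - r, hL (.inl rfl), sub_nonneg.2 (hU (.inl rfl)), by ring,
    fun x hx y hy i => ⟨?_, ?_⟩⟩
  · linarith [hU (.inr ⟨i, x, hx, y, hy, rfl⟩)]
  · linarith [hL (.inr ⟨i, x, hx, y, hy, rfl⟩)]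

/-- For fixed `i`, the value `a i` is a common point of the intervals about `F i x` with radius `min
(dist x u - r) (dist x v - s)`. Pairwise intersection suffices: `exists_radii` covers equal centres,
and `h₁` with `r + s = D` covers mixed ones. -/
theorem exists_radii_centres (hD : 0 ≤ D) (hF : ∀ i x y, |F i x - F i y| ≤ dist x y)
    (h₁ : ∀ x ∉ A, ∀ y ∉ A, ∀ i, |F i x - F i y| + D ≤ dist x u + dist y v)
    (h₂ : ∀ x ∉ A, ∀ y ∉ A, ∀ z ∉ A, ∀ w ∉ A, ∀ i j,
      F i x - F i y + (F j z - F j w) + 2 * D ≤ dist x u + dist y u + dist z v + dist w v) :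
    ∃ (r s : ℝ) (a : ι → ℝ), 0 ≤ r ∧ 0 ≤ s ∧ r + s = D ∧ ∀ i, ∀ x ∉ A,
      |F i x - a i| + r ≤ dist x u ∧ |F i x - a i| + s ≤ dist x v := by
  obtain ⟨r, s, hr, hs, hrs, h⟩ := exists_radii hD hF h₂
  refine ⟨r, s, ?_⟩
  suffices ∀ i, ∃ a, ∀ x ∉ A, |F i x - a| + r ≤ dist x u ∧ |F i x - a| + s ≤ dist x v by
    choose a ha using this
    exact ⟨a, hr, hs, hrs, ha⟩
  intro i
  rcases Set.eq_empty_or_nonempty Aᶜ with hA | hA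
  · exact ⟨0, fun x hx => absurd hx (Set.eq_empty_iff_forall_notMem.1 hA x)⟩
  let m : M → ℝ := fun x => min (dist x u - r) (dist x v - s)
  obtain ⟨a, hL, hU⟩ := exists_between_of_forall_le (hA.image fun x => F i x - m x)
    (hA.image fun x => F i x + m x) (by
      rintro _ ⟨x, hx, rfl⟩ _ ⟨y, hy, rfl⟩
      have e₁ := h x hx y hy i
      have e₂ := h₁ x hx y hy i
      have e₃ := h₁ y hy x hx i
      rw [abs_sub_comm] at e₃
      have e₄ := le_abs_self (F i x - F i y)
      simp only [m]
      rcases min_choice (dist x u - r) (dist x v - s) with h | h <;>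
      rcases min_choice (dist y u - r) (dist y v - s) with h' | h' <;>
      rw [h, h'] <;> linarith)
  refine ⟨a, fun x hx => ?_⟩
  have hx' : |F i x - a| ≤ m x :=
    abs_sub_le_iff.2 ⟨by linarith [hL ⟨x, hx, rfl⟩], by linarith [hU ⟨x, hx, rfl⟩]⟩
  exact ⟨by linarith [hx'.trans (min_le_left _ _)], by linarith [hx'.trans (min_le_right _ _)]⟩

end Parameters

/-! ### The de Leeuw embedding and the proof of the SSD2P. -/

section DeLeeuw

open scoped ENNReal

variable {M : Type u} [MetricSpace M] {o : M}

/-- The de Leeuw map, sending a Lipschitz function to its difference quotients. -/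
noncomputable def deLeeuw (o : M) :
    LipZero o →ₗᵢ[ℝ] lp (fun _ : OffDiagPair M => ℝ) ∞ where
  toFun f := ⟨fun p => (f p.1.1 - f p.1.2) / dist p.1.1 p.1.2, memℓp_infty (by
    simpa only [Real.norm_eq_abs, abs_div, abs_dist] using f.bddAbove_quotients)⟩
  map_add' f g := by
    ext p
    simp only [LipZero.add_apply, lp.coeFn_add, Pi.add_apply]
    ring
  map_smul' c f := by
    ext p
    simp only [LipZero.smul_apply, lp.coeFn_smul, Pi.smul_apply, smul_eq_mul, RingHom.id_apply]
    ring
  norm_map' f := by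
    rw [lp.norm_eq_ciSup, LipZero.norm_def]
    simp

theorem deLeeuw_apply (f : LipZero o) (p : OffDiagPair M) :
    deLeeuw o f p = (f p.1.1 - f p.1.2) / dist p.1.1 p.1.2 := rfl

theorem exists_extension_deLeeuw (φ : StrongDual ℝ (LipZero o)) :
    ∃ Φ : StrongDual ℝ (lp (fun _ : OffDiagPair M => ℝ) ∞), ∀ f, Φ (deLeeuw o f) = φ f := by
  obtain ⟨Φ, hΦ, -⟩ := exists_extension_norm_eq (𝕜 := ℝ) (deLeeuw o).range
    (φ ∘L ((deLeeuw o).equivRange.symm.toContinuousLinearEquiv : _ →L[ℝ] LipZero o))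
  refine ⟨Φ, fun f => ?_⟩
  have := hΦ ((deLeeuw o).equivRange f)
  simpa using this

/-- Finitely many functionals on `Lip₀(M)` are dominated by one positive finitely additive measure,
on functions that are constant outside a set. -/
theorem exists_ba_dominating_lipZero {n : ℕ} (φ : Fin n → StrongDual ℝ (LipZero o)) :
    ∃ μ ∈ ba (OffDiagPair M), (∀ S, 0 ≤ μ S) ∧ ∀ j (A : Set M) (h : LipZero o) (c C : ℝ),
      ‖h‖ ≤ C → (∀ x ∉ A, h x = c) → |φ j h| ≤ C * μ (gammaSet A) := by
  choose Φ hΦ using fun j => exists_extension_deLeeuw (φ j)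
  obtain ⟨μ, hμ, hμ0, hdom⟩ := exists_ba_dominating Φ
  refine ⟨μ, hμ, hμ0, fun j A h c C hC hA => ?_⟩
  rw [← hΦ j h]
  refine hdom j _ _ C ((norm_nonneg h).trans hC) (fun p => ?_) fun p hp => ?_
  · rw [← (deLeeuw o).norm_map] at hC
    exact (lp.norm_apply_le_norm ENNReal.top_ne_zero _ p).trans hC
  · rw [gammaSet, Set.mem_ofPred_eq, not_or] at hp
    rw [deLeeuw_apply, hA _ hp.1, hA _ hp.2, sub_self, zero_div]

theorem LipZero.exists_of_abs_sub_le {G : M → ℝ} (hG : ∀ x y, |G x - G y| ≤ dist x y) :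
    ∃ g : LipZero o, ∀ x, g x = G x - G o :=
  ⟨⟨fun x => G x - G o, ⟨1, LipschitzWith.of_dist_le_mul fun x y => by
    simpa [Real.dist_eq] using hG x y⟩, sub_self _⟩, fun _ => rfl⟩

theorem exists_lt_apply_of_norm_eq_one {X : Type*} [NormedAddCommGroup X] [NormedSpace ℝ X]
    {φ : StrongDual ℝ X} (hφ : ‖φ‖ = 1) {α : ℝ} (hα : 0 < α) :
    ∃ f : X, ‖f‖ ≤ 1 ∧ 1 - α < φ f := by
  obtain ⟨f, hf, h⟩ := φ.exists_lt_apply_of_lt_opNorm (r := 1 - α) (by linarith)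
  rcases abs_cases (φ f) with h' | h' <;> rw [Real.norm_eq_abs, h'.1] at h
  · exact ⟨f, hf.le, h⟩
  · exact ⟨-f, by simpa using hf.le, by simpa using h⟩

theorem FSLTP.exists_of_fintype (hM : FSLTP o)
    {μ : AddContent ℝ (Set.univ : Set (Set (OffDiagPair M)))}
    (hμ : μ ∈ ba (OffDiagPair M)) (hμ0 : ∀ S, 0 ≤ μ S) {ε : ℝ} (hε : 0 < ε) (hε1 : ε < 1)
    {ι : Type*} [Fintype ι] (f : ι → LipZero o) (hf : ∀ i, ‖f i‖ ≤ 1) :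
    ∃ (A : Set M) (u v : M), μ (gammaSet A) < ε ∧ u ≠ v ∧
      (∀ x ∉ A, ∀ y ∉ A, ∀ i, (1 - ε) * (f i x - f i y + dist u v) ≤ dist x u + dist y v) ∧
      (∀ x ∉ A, ∀ y ∉ A, ∀ z ∉ A, ∀ w ∉ A, ∀ i j,
        (1 - ε) * (f i x - f i y + (f j z - f j w) + 2 * dist u v) ≤
          dist x u + dist y u + dist z v + dist w v) := by
  let e := Fintype.equivFin ι
  obtain ⟨A, u, v, hA, -, -, huv, h₁, h₂⟩ := hM μ hμ hμ0 ε hε hε1 _ (f ∘ e.symm) fun i => hf _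
  refine ⟨A, u, v, hA, huv, fun x hx y hy i => ?_, fun x hx y hy z hz w hw i j => ?_⟩
  · simpa using h₁ x hx y hy (e i)
  · simpa using h₂ x hx y hy z hz w hw (e i) (e j)

theorem FSLTP.ssd2p (hM : FSLTP o) : SSD2P (LipZero o) := by
  intro n S hS ε hε
  choose φ hφ α hα hS using hS
  choose f hf hfα using fun i => exists_lt_apply_of_norm_eq_one (hφ i) (hα i)
  -- The loss `4 * δ` splits into `δ` for scaling `f i`, `2 * δ` for changing it inside `A`, and `δ`
  -- for `g`.
  obtain ⟨δ, ⟨⟨hδ, hδ1⟩, hδε⟩, hδ0⟩ : ∃ δ : ℝ,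
      (((∀ i, 1 - α i < φ i (f i) - 4 * δ) ∧ δ < 1) ∧ δ < ε) ∧ 0 < δ := by
    refine (((Filter.Eventually.and (Filter.Eventually.and ?_ ?_) ?_).filter_mono
      nhdsWithin_le_nhds).and (self_mem_nhdsWithin (a := (0 : ℝ)) (s := Set.Ioi 0))).exists
    · rw [Filter.eventually_all]
      intro i
      have : ContinuousAt (fun δ : ℝ => φ i (f i) - 4 * δ) 0 := by fun_prop
      exact this.eventually (lt_mem_nhds (by simpa using hfα i))
    · exact gt_mem_nhds one_pos
    · exact gt_mem_nhds hε
  obtain ⟨μ, hμ, hμ0, hdom⟩ := exists_ba_dominating_lipZero φ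
  -- Including the negatives `-f i` puts an absolute value into the first inequality.
  obtain ⟨A, u, v, hA, huv, h₁, h₂⟩ := hM.exists_of_fintype hμ hμ0 hδ0 hδ1
    (Sum.elim f fun i => -f i) (by rintro (i | i) <;> simpa using hf i)
  have hd : 0 < dist u v := dist_pos.2 huv
  have hneg : ∀ (g : LipZero o) x, (-g) x = -g x := fun g x => rfl
  have hsub : ∀ (g h : LipZero o) x, (g - h) x = g x - h x := fun g h x => rfl
  let F : Fin n → M → ℝ := fun i x => (1 - δ) * f i x
  have hF : ∀ i x y, |F i x - F i y| ≤ dist x y := by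
    intro i x y
    rw [← mul_sub, abs_mul, abs_of_pos (by linarith)]
    refine (mul_le_of_le_one_left (abs_nonneg _) (by linarith)).trans ?_
    exact ((f i).abs_sub_le_norm_mul x y).trans (mul_le_of_le_one_left dist_nonneg (hf i))
  obtain ⟨r, s, a, hr, hs, hrs, ha⟩ := exists_radii_centres (A := A) (u := u) (v := v)
    (D := (1 - δ) * dist u v) (by nlinarith) hF (fun x hx y hy i => by
      have e₁ := h₁ x hx y hy (.inl i)
      have e₂ := h₁ x hx y hy (.inr i)
      simp only [Sum.elim_inl, Sum.elim_inr, hneg] at e₁ e₂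
      simp only [F]
      rw [← le_sub_iff_add_le, abs_le]
      constructor <;> linarith) fun x hx y hy z hz w hw i j => by
      have e := h₂ x hx y hy z hz w hw (.inl i) (.inl j)
      simp only [Sum.elim_inl] at e
      simp only [F]
      linarith
  have hrs' : r + s ≤ dist u v := by nlinarith
  have key := fun i => abs_clampAt_sub_add_abs_conePair_sub_le (a := a i) (hF i) hrs'
  have hG : ∀ x y, |conePair u v r s x - conePair u v r s y| ≤ dist x y := fun x y =>
    (le_add_of_nonneg_left (abs_nonneg _)).trans (abs_clampAt_sub_add_abs_conePair_sub_le
      (a := 0) (F := fun _ => 0) (by simp) hrs' x y)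
  obtain ⟨g, hg⟩ := LipZero.exists_of_abs_sub_le (o := o) hG
  choose h hh using fun i => LipZero.exists_of_abs_sub_le (o := o)
    (abs_clampAt_sub_le (u := u) (v := v) (r := r) (s := s) (a := a i) (hF i))
  have hg1 : ‖g‖ ≤ 1 := g.norm_le_of_forall zero_le_one fun x y => by
    simpa [hg] using hG x y
  have hh1 : ∀ i, ‖h i‖ ≤ 1 := fun i => (h i).norm_le_of_forall zero_le_one fun x y => by
    simpa [hh] using abs_clampAt_sub_le (hF i) x y
  have hadd : ∀ i, ‖h i + g‖ ≤ 1 := fun i =>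
    (h i + g).norm_le_of_forall zero_le_one fun x y => by
      refine le_trans ?_ ((key i x y).trans_eq (one_mul _).symm)
      refine le_trans (le_of_eq ?_) (abs_add_le _ _)
      simp only [LipZero.add_apply, hg, hh]
      congr 1; ring
  have hsub1 : ∀ i, ‖h i - g‖ ≤ 1 := fun i =>
    (h i - g).norm_le_of_forall zero_le_one fun x y => by
      refine le_trans ?_ ((key i x y).trans_eq (one_mul _).symm)
      refine le_trans (le_of_eq ?_) (abs_sub _ _)
      simp only [hsub, hg, hh]
      congr 1; ring
  -- Subtracting the value at `o` leaves `g` constant, though perhaps not zero, outside `A`.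
  have hφg : ∀ i, |φ i g| ≤ 1 * μ (gammaSet A) := fun i =>
    hdom i A g (0 - conePair u v r s o) 1 hg1 fun x hx => by
      have := ha i x hx
      rw [hg, conePair_eq_zero] <;> linarith [abs_nonneg (F i x - a i)]
  have hφh : ∀ i, |φ i (h i - (1 - δ) • f i)| ≤ 2 * μ (gammaSet A) := by
    refine fun i => hdom i A _ (0 - clampAt u v r s (a i) (F i) o) 2 ?_ fun x hx => ?_
    · refine (norm_sub_le _ _).trans ?_
      rw [norm_smul, Real.norm_of_nonneg (by linarith)]
      nlinarith [hh1 i, hf i, norm_nonneg (f i)]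
    · rw [hsub, hh, clampAt_eq_of_abs_sub_le (ha i x hx).1 (ha i x hx).2, LipZero.smul_apply]
      ring
  have hlow : ∀ i, 1 - α i < φ i (h i) - |φ i g| := by
    intro i
    have e₁ := (abs_le.1 (hφh i)).1
    rw [map_sub, map_smul, smul_eq_mul] at e₁
    have e₂ : φ i (f i) ≤ 1 := (le_abs_self _).trans
      ((φ i).le_of_opNorm_le_of_le (hφ i).le (hf i) |>.trans_eq (one_mul 1))
    nlinarith [hφg i, hδ i]
  -- The cone tips give `g u - g v = r + s`.
  have hgn : (1 - δ) * dist u v ≤ ‖g‖ * dist u v := by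
    refine le_trans ?_ (g.abs_sub_le_norm_mul u v)
    rw [← hrs, hg, hg]
    refine le_trans (le_of_eq ?_) (le_abs_self _)
    have hu : conePair u v r s u = r := by
      rw [conePair, dist_self, max_eq_left, max_eq_right] <;> linarith
    have hv : conePair u v r s v = -s := by
      rw [conePair, dist_self, dist_comm, max_eq_right, max_eq_left] <;> linarith
    rw [hu, hv]
    ring
  refine ⟨h, g, fun i => ?_, hg1, ?_, fun i => ?_⟩
  · rw [hS]
    exact ⟨hh1 i, by linarith [hlow i, abs_nonneg (φ i g)]⟩
  · linarith [le_of_mul_le_mul_right hgn hd]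
  · rw [hS]
    refine ⟨⟨hadd i, ?_⟩, hsub1 i, ?_⟩
    · rw [map_add]; linarith [hlow i, neg_abs_le (φ i g)]
    · rw [map_sub]; linarith [hlow i, le_abs_self (φ i g)]

end DeLeeuw

theorem mainTheorem3 :
    (∀ (M : Type u) [MetricSpace M] (o : M), FSLTP o → SSD2P (LipZero o)) ∧
      (∀ (M : Type u) [MetricSpace M] (o : M), SeqSLTP M → FSLTP o) ∧
      ∃ (M : Type) (_ : MetricSpace M) (o : M), FSLTP o ∧ ¬ SeqSLTP M :=
  ⟨fun _ _ _ h => h.ssd2p, fun _ _ o h => h.fsltp o,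
    FreeVertex, inferInstance, .base 0, FreeVertex.fsltp _, FreeVertex.not_seqSLTP⟩
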